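/- \textbf{Model.} Let $\mathcal S\subset\mathbb R^2$ be a domain containing $M$ distinct possible source locations $o_0,\dots,o_{M-1}$, and for $n\ge 1$ let $\mathcal A_n\subset\mathcal S$ be the known finite (possibly empty) set of sensor locations at time slot $n$ (put $\mathcal A_0=\emptyset$). Let $\mathfrak R$ be the smallest integer such that $\|a-o_m\|<\mathfrak R$ for all $a\in\mathcal S$ and all $m$ (assumed to exist). On a probability space, the change point $t$ has the geometric law $\mathbb P(t=k)=\rho(1-\rho)^k$, $k=0,1,2,\dots$, with $\rho\in(0,1)$, and the source $O$ is independent of $t$ and uniform on $\{o_0,\dots,o_{M-1}\}$. The radius $R_n$ of the event satisfies $R_n=0$ for $n<t$ and $R_t=1$; thereafter, independently of $O$, it grows by $1$ with probability $\rho_1\in(0,1]$ and stays unchanged with probability $1-\rho_1$ at each time slot, until it reaches $\mathfrak R$, where it remains. At each time slot $n\ge1$ every sensor $a\in\mathcal A_n$ yields a real observation $X_n^{(a)}$; conditionally on $O=o_m$ and on the radii, all observations are independent, and $X_n^{(a)}$ has Lebesgue density $f_1^{(a,o_m)}$ if $\|a-o_m\|<R_n$ and $f_0$ otherwise. A procedure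 is a stopping time $T$ (with values in $\{0,1,2,\dots\}\cup\{\infty\}$) with respect to the filtration generated by the observations. Put $\mathrm{ADD}(T)=\mathbb E[(T-t)^+]$, $\mathrm{PFA}(T)=\mathbb P(T<t)$ and $\Delta_\alpha=\{T:\mathrm{PFA}(T)\le\alpha\}$. For $k\le n$ let $\eta(n,k,m)=\{a\in\mathcal A_n:\|a-o_m\|<n-k+1\}$ and $$Z_n^{k,m}=\sum_{i=k}^{n}\log\frac{\prod_{a\in\eta(i,k,m)}f_1^{(a,o_m)}(X_i^{(a)})\prod_{a\in\mathcal A_i\setminus\eta(i,k,m)}f_0(X_i^{(a)})}{\prod_{a\in\mathcal A_i}f_0(X_i^{(a)})},$$ with values in the extended real line. \textbf{Lemma.} Suppose that $\rho_1=1$ and that there are real numbers $q_0,\dots,q_{M-1}$ such that for every $k\ge0$ and every $m$, almost surely on $\{t=k,\,O=o_m\}$, $$\frac1n Z_{k+n}^{k,m}\longrightarrow q_m\qquad(n\to\infty).$$ Then, for $\alpha\in(0,1)$, $$\inf_{T\in\Delta_\alpha}\mathrm{ADD}(T)\ \ge\ \frac1M\sum_{m=0}^{M-1}\frac{|\log\alpha|}{q_m+|\log(1-\rho)|}\,(1+o(1)),$$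 where $o(1)\to0$ as $\alpha\to0$. -/

import Mathlib

open MeasureTheory ProbabilityTheory Filter Topology
open scoped ENNReal NNReal

noncomputable section

/-- The plane in which sensors and sources are located. -/
abbrev Plane : Type := EuclideanSpace ℝ (Fin 2)

/-- `f` is a probability density function on the real line (with respect to Lebesgue measure). -/
def IsPdf (f : ℝ → ℝ≥0) : Prop :=
  Measurable f ∧ ∫⁻ x, (f x : ℝ≥0∞) = 1

/-- One-step transition probability of the radius of the disruption after the initial event:
`r → r + 1` with probability `ρ₁`, `r → r` with probability `1 - ρ₁`, as long as `r` is not the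
maximal radius `Rmax`, which is absorbing. -/
def radiusStep (ρ₁ : ℝ) (Rmax r r' : ℕ) : ℝ :=
  if r = Rmax then (if r' = Rmax then 1 else 0)
  else if r' = r + 1 then ρ₁
  else if r' = r then 1 - ρ₁
  else 0

/-- A radially propagating spatial event observed by a (possibly mobile) sensor network, with `M`
possible source locations, on the probability space `(Ω, P)`. -/
structure RadialModel {Ω : Type*} [MeasurableSpace Ω] (P : Measure Ω) (M : ℕ) where
  /-- parameter of the geometric prior of the change point -/
  ρ : ℝ
  ρ_pos : 0 < ρ
  ρ_lt_one : ρ < 1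
  /-- probability that the radius grows during a time slot -/
  ρ₁ : ℝ
  ρ₁_pos : 0 < ρ₁
  ρ₁_le_one : ρ₁ ≤ 1
  /-- the spatial domain of interest -/
  S : Set Plane
  /-- the possible source locations -/
  o : Fin M → Plane
  o_injective : Function.Injective o
  o_mem : ∀ m, o m ∈ S
  /-- the sensor locations at each time slot -/
  A : ℕ → Finset Plane
  A_subset : ∀ n, (A n : Set Plane) ⊆ S
  /-- data are collected in the time slots `1, 2, …` only -/
  A_zero : A 0 = ∅
  /-- the smallest radius with which the disruption covers the whole domain, whatever its origin -/
  Rmax : ℕ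
  Rmax_isLeast : IsLeast {r : ℕ | ∀ m, S ⊆ {a | ‖a - o m‖ < (r : ℝ)}} Rmax
  /-- density of an observation at a sensor that is not exposed to the disruption -/
  f₀ : ℝ → ℝ≥0
  f₀_pdf : IsPdf f₀
  /-- `f₁ a s` is the density of an observation at an exposed sensor located at `a`, when the
  source is located at `s` -/
  f₁ : Plane → Plane → ℝ → ℝ≥0
  f₁_pdf : ∀ a ∈ S, ∀ m, IsPdf (f₁ a (o m))
  /-- the change point -/
  t : Ω → ℕ
  t_measurable : Measurable t
  /-- index of the true source location -/
  O : Ω → Fin M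
  O_measurable : Measurable O
  /-- `R n` is the radius of the disruption at time slot `n` -/
  R : ℕ → Ω → ℕ
  R_measurable : ∀ n, Measurable (R n)
  /-- `X n a` is the observation at time slot `n` of the sensor at `a` (meaningful for `a ∈ A n`) -/
  X : ℕ → Plane → Ω → ℝ
  X_measurable : ∀ n, ∀ a ∈ A n, Measurable (X n a)
  t_geometric : ∀ k : ℕ, P {ω | t ω = k} = ENNReal.ofReal (ρ * (1 - ρ) ^ k)
  O_uniform : ∀ m, P {ω | O ω = m} = ENNReal.ofReal (1 / (M : ℝ))
  t_indep_O : IndepFun t O P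
  R_before : ∀ ω n, n < t ω → R n ω = 0
  R_at : ∀ ω, R (t ω) ω = 1
  /-- after the change point the radius is a Markov chain with transitions `radiusStep`,
  independent of the location of the source -/
  R_step : ∀ (k : ℕ) (m : Fin M) (r : ℕ → ℕ) (n : ℕ), k ≤ n →
    P {ω | t ω = k ∧ O ω = m ∧ ∀ j ≤ n + 1, R j ω = r j} =
      ENNReal.ofReal (radiusStep ρ₁ Rmax (r n) (r (n + 1))) *
        P {ω | t ω = k ∧ O ω = m ∧ ∀ j ≤ n, R j ω = r j}
  /-- conditionally on the states `(O, R_0), …, (O, R_N)`, the observations up to time `N` are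
  independent over sensors and time slots; the one at time `n` of the sensor at `a` has density
  `f₁ a (o m)` if `a` is exposed at time `n`, and `f₀` otherwise -/
  X_law : ∀ (N : ℕ) (m : Fin M) (r : ℕ → ℕ) (B : ℕ → Plane → Set ℝ),
    (∀ n a, MeasurableSet (B n a)) →
    P {ω | (O ω = m ∧ ∀ j ≤ N, R j ω = r j) ∧ ∀ n ≤ N, ∀ a ∈ A n, X n a ω ∈ B n a} =
      P {ω | O ω = m ∧ ∀ j ≤ N, R j ω = r j} *
        ∏ n ∈ Finset.range (N + 1), ∏ a ∈ A n,
          ∫⁻ x in B n a, ((if ‖a - o m‖ < (r n : ℝ) then f₁ a (o m) x else f₀ x : ℝ≥0) : ℝ≥0∞)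

namespace RadialModel

variable {Ω : Type*} [mΩ : MeasurableSpace Ω] {P : Measure Ω} {M : ℕ}

/-- The information available at time `n`: the observations in the time slots `1, …, n`. -/
def info (𝓜 : RadialModel P M) : Filtration ℕ mΩ where
  seq n := ⨆ j ≤ n, ⨆ a ∈ 𝓜.A j, MeasurableSpace.comap (𝓜.X j a) inferInstance
  mono' _ _ hnm := iSup₂_le fun j hj =>
    le_iSup₂_of_le (f := fun j _ => ⨆ a ∈ 𝓜.A j, MeasurableSpace.comap (𝓜.X j a) inferInstance)
      j (hj.trans hnm) le_rfl
  le' _ := iSup₂_le fun j _ => iSup₂_le fun a ha => (𝓜.X_measurable j a ha).comap_le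

/-- The average detection delay `E[(T - t)⁺]` of `T` (subtraction in `ℕ∞` is truncated at `0`). -/
def ADD (𝓜 : RadialModel P M) (T : Ω → ℕ∞) : ℝ≥0∞ :=
  ∫⁻ ω, ((T ω - (𝓜.t ω : ℕ∞) : ℕ∞) : ℝ≥0∞) ∂P

/-- The probability of false alarm `P(T < t)`. -/
def PFA (𝓜 : RadialModel P M) (T : Ω → ℕ∞) : ℝ≥0∞ :=
  P {ω | T ω < (𝓜.t ω : ℕ∞)}

/-- The stopping times of the observations whose probability of false alarm is at most `α`. -/
def Δ (𝓜 : RadialModel P M) (α : ℝ) : Set (Ω → ℕ∞) :=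
  {T | IsStoppingTime 𝓜.info T ∧ 𝓜.PFA T ≤ ENNReal.ofReal α}

open Classical in
/-- Sensors observing the event at time `n` if it took place at time `k` at the `m`-th source
location (and propagates deterministically). -/
def η (𝓜 : RadialModel P M) (n k : ℕ) (m : Fin M) : Finset Plane :=
  {a ∈ 𝓜.A n | ‖a - 𝓜.o m‖ < (n : ℝ) - k + 1}

open Classical in
/-- Joint density, at the data `x`, of the observations at time `n` on `{t = k, O = o m}`. -/
def jointPdf₁ (𝓜 : RadialModel P M) (k : ℕ) (m : Fin M) (n : ℕ) (x : Plane → ℝ) : ℝ≥0 :=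
  (∏ a ∈ 𝓜.η n k m, 𝓜.f₁ a (𝓜.o m) (x a)) * ∏ a ∈ 𝓜.A n \ 𝓜.η n k m, 𝓜.f₀ (x a)

/-- Joint density, at the data `x`, of the observations at time `n` on `{t = ∞}`. -/
def jointPdf₀ (𝓜 : RadialModel P M) (n : ℕ) (x : Plane → ℝ) : ℝ≥0 :=
  ∏ a ∈ 𝓜.A n, 𝓜.f₀ (x a)

/-- The log-likelihood ratio of `{t = k, O = o m}` against `{t = ∞}` at time `n`, with values in
the extended reals (`log (c / 0) = ∞` for `c > 0`, and `log 0 = -∞`). -/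
def Z (𝓜 : RadialModel P M) (k : ℕ) (m : Fin M) (n : ℕ) (ω : Ω) : EReal :=
  ∑ i ∈ Finset.Icc k n,
    ENNReal.log ((𝓜.jointPdf₁ k m i (fun a => 𝓜.X i a ω) : ℝ≥0∞) /
      (𝓜.jointPdf₀ i (fun a => 𝓜.X i a ω) : ℝ≥0∞))

end RadialModel

end

/-!
The bound comes from a change of measure, made at one time only. Fix a change point `k`, a source
`o m` and a horizon `n`. As `ρ₁ = 1`, the radius follows a deterministic path on `{t = k, O = o m}`,
so the observations up to time `k + n` have an explicit product density there, and on
`{k + n < t}` they have the product density of the `f₀`. The ratio of the two densities is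
`exp (Z k m (k + n))`. For an event `E` in the information at time `k + n` this gives
(`measure_change_point_inter_Z_le`)

`P (t = k, O = o m, E, Z ≤ a) ≤ exp a * ρ / (1 - ρ) ^ (n + 1) * P (k + n < t, E)`.

With `E = {T ≤ k + n}` the last probability is at most `P (T < t) ≤ α`. So, on `{t = k, O = o m}`,
the procedure `T` stops by time `k + n` only if `Z` is above `a`, or else with probability at most
`exp a * ρ / (1 - ρ) ^ (n + 1) * α` (`measureReal_changeEvent_sub_le`). Take for `n` the fraction
`1 - e` of `|log α| / (q m + |log (1 - ρ)|)`, and for `a` a multiple of `n` slightly above `q m * n`.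
Then the first possibility has vanishing probability since `Z / n → q m`, and the second bound is of
order `α ^ (e ^ 2)` (`tendsto_earlyBound`). Hence, uniformly over the procedures of level `α`, the
delay exceeds `n` with probability tending to `1` on each `{t = k, O = o m}`. Adding this up
over the finitely many `k < K` and all `m` bounds the average delay (`ofReal_sum_le_ADD`), and
`K → ∞`, `e → 0` yields the constant (`eventually_le_iInf_ADD`).

The change of measure with `E` the whole space also shows that `q m ≥ 0` (`limit_nonneg`): the
event `Z ≤ b * n` with `b < 0` has exponentially small probability. So the denominators are positive.
-/

/-! ### Product densities and logarithms of likelihood ratios -/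

/-- Tonelli's theorem for a finite product of functions of one variable each. Finiteness of the
integrals allows a reduction to Bochner integrals. -/
theorem lintegral_pi_prod {ι : Type*} [Fintype ι] (μ : ι → Measure ℝ) [∀ i, SigmaFinite (μ i)]
    (f : ι → ℝ → ℝ≥0) (hf : ∀ i, Measurable (f i)) (hfin : ∀ i, ∫⁻ x, f i x ∂μ i ≠ ∞) :
    ∫⁻ x, ∏ i, (f i (x i) : ℝ≥0∞) ∂Measure.pi μ = ∏ i, ∫⁻ x, f i x ∂μ i := by
  have hint : ∀ i, Integrable (fun x => (f i x : ℝ)) (μ i) := fun i => by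
    refine ⟨(hf i).coe_nnreal_real.aestronglyMeasurable, ?_⟩
    rw [hasFiniteIntegral_iff_ofReal (ae_of_all _ fun x => NNReal.coe_nonneg _)]
    simpa using (hfin i).lt_top
  have h := congrArg ENNReal.ofReal (integral_fintype_prod_eq_prod (𝕜 := ℝ) (μ := μ)
    (fun i x => (f i x : ℝ)))
  rw [ENNReal.ofReal_prod_of_nonneg fun i _ => integral_nonneg fun x => NNReal.coe_nonneg _,
    ofReal_integral_eq_lintegral_ofReal (Integrable.fintype_prod hint)
      (ae_of_all _ fun x => Finset.prod_nonneg fun i _ => NNReal.coe_nonneg _)] at h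
  convert h using 2
  · ext x
    rw [ENNReal.ofReal_prod_of_nonneg fun i _ => NNReal.coe_nonneg _]
    simp
  · rename_i i _
    rw [ofReal_integral_eq_lintegral_ofReal (hint i) (ae_of_all _ fun x => NNReal.coe_nonneg _)]
    simp

theorem pi_withDensity {ι : Type*} [Fintype ι] (f : ι → ℝ → ℝ≥0) (hf : ∀ i, IsPdf (f i)) :
    Measure.pi (fun i => (volume : Measure ℝ).withDensity fun x => f i x) =
      (volume : Measure (ι → ℝ)).withDensity fun x => ∏ i, (f i (x i) : ℝ≥0∞) := by
  have : ∀ i, IsFiniteMeasure ((volume : Measure ℝ).withDensity fun x => f i x) := fun i =>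
    isFiniteMeasure_withDensity (by rw [(hf i).2]; exact ENNReal.one_ne_top)
  refine Measure.pi_eq fun s hs => ?_
  rw [withDensity_apply _ (MeasurableSet.univ_pi hs), volume_pi, Measure.restrict_pi_pi,
    lintegral_pi_prod _ f (fun i => (hf i).1) fun i => ?_]
  · exact Finset.prod_congr rfl fun i _ => (withDensity_apply _ (hs i)).symm
  · refine ne_top_of_le_ne_top ENNReal.one_ne_top ?_
    rw [← (hf i).2]
    exact setLIntegral_le_lintegral _ _

theorem sum_log_eq_log_prod {ι : Type*} (s : Finset ι) (f : ι → ℝ≥0∞) :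
    ∑ i ∈ s, ENNReal.log (f i) = ENNReal.log (∏ i ∈ s, f i) := by
  classical
  induction s using Finset.induction_on with
  | empty => simp
  | insert i s hi ih => rw [Finset.sum_insert hi, Finset.prod_insert hi, ih, ENNReal.log_mul_add]

/-- A bound for a product of likelihood ratios bounds the likelihood itself. If some `q i = 0`, then
either that ratio is `∞`, which a finite `c` excludes, or the ratio `0 / 0 = 0` goes with a zero
factor on the left. -/
theorem prod_le_mul_prod_of_prod_div_le {ι : Type*} (s : Finset ι) (p q : ι → ℝ≥0) {c : ℝ≥0∞}
    (hc : c ≠ ∞) (h : ∏ i ∈ s, ((p i : ℝ≥0∞) / q i) ≤ c) :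
    ∏ i ∈ s, (p i : ℝ≥0∞) ≤ c * ∏ i ∈ s, (q i : ℝ≥0∞) := by
  by_cases hp : ∃ i ∈ s, p i = 0
  · obtain ⟨i, hi, h0⟩ := hp
    rw [Finset.prod_eq_zero hi (by simp [h0])]
    exact zero_le
  push Not at hp
  have hq : ∀ i ∈ s, q i ≠ 0 := by
    intro i hi h0
    refine ne_top_of_le_ne_top hc h ?_
    classical
    rw [← Finset.mul_prod_erase s _ hi, h0, ENNReal.coe_zero,
      ENNReal.div_zero (by simpa using hp i hi)]
    refine ENNReal.top_mul (Finset.prod_ne_zero_iff.2 fun j hj => ?_)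
    exact (ENNReal.div_pos (by simpa using hp j (Finset.mem_of_mem_erase hj))
      ENNReal.coe_ne_top).ne'
  calc ∏ i ∈ s, (p i : ℝ≥0∞) = (∏ i ∈ s, ((p i : ℝ≥0∞) / q i)) * ∏ i ∈ s, (q i : ℝ≥0∞) := by
        rw [← Finset.prod_mul_distrib]
        exact Finset.prod_congr rfl fun i hi =>
          (ENNReal.div_mul_cancel (by simpa using hq i hi) ENNReal.coe_ne_top).symm
    _ ≤ _ := by gcongr

/-! ### Limits -/

/-- An asymptotic lower bound up to factors `1 - δ` can be written with one factor `1 + o(1)`, valid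
for all `α` in `(0, 1)`. -/
theorem exists_tendsto_zero_of_eventually_le (I : ℝ → ℝ≥0∞) (L : ℝ → ℝ) {C : ℝ} (hC : 0 < C)
    (hL0 : ∀ α, 0 < α → α < 1 → 0 < L α)
    (h : ∀ δ : ℝ, 0 < δ → δ < 1 →
      ∀ᶠ α in 𝓝[>] (0 : ℝ), ENNReal.ofReal ((1 - δ) * (C * L α)) ≤ I α) :
    ∃ ε : ℝ → ℝ, Tendsto ε (𝓝[>] 0) (𝓝 0) ∧
      ∀ α : ℝ, 0 < α → α < 1 → ENNReal.ofReal (C * L α * (1 + ε α)) ≤ I α := by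
  -- `1 + ε` is the ratio of `I` to `C * L`, capped at `1`, so that `ε → 0` also if `I` is larger
  refine ⟨fun α => (min (I α) (ENNReal.ofReal (C * L α))).toReal / (C * L α) - 1, ?_, ?_⟩
  · have hpos : ∀ᶠ α in 𝓝[>] (0 : ℝ), 0 < C * L α := by
      filter_upwards [Ioo_mem_nhdsGT (zero_lt_one (α := ℝ))] with α hα
      exact mul_pos hC (hL0 α hα.1 hα.2)
    rw [Metric.tendsto_nhds]
    intro δ' hδ'
    have hδ : 0 < min (δ' / 2) (1 / 2) := by positivity
    filter_upwards [hpos, h _ hδ (by norm_num)] with α hα hI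
    have hδ1 : min (δ' / 2) (1 / 2) ≤ δ' / 2 := min_le_left _ _
    have hδ2 : min (δ' / 2) (1 / 2) ≤ 1 / 2 := min_le_right _ _
    set δ := min (δ' / 2) (1 / 2)
    have hup : (min (I α) (ENNReal.ofReal (C * L α))).toReal ≤ C * L α :=
      ENNReal.toReal_le_of_le_ofReal hα.le (min_le_right _ _)
    have hlo : (1 - δ) * (C * L α) ≤ (min (I α) (ENNReal.ofReal (C * L α))).toReal := by
      rw [← ENNReal.ofReal_le_iff_le_toReal (ne_top_of_le_ne_top ENNReal.ofReal_ne_top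
        (min_le_right _ _))]
      refine le_min hI (ENNReal.ofReal_le_ofReal ?_)
      nlinarith
    rw [← le_div_iff₀ hα] at hlo
    rw [← div_le_one hα] at hup
    rw [Real.dist_eq, sub_zero, abs_lt]
    constructor <;> linarith
  · intro α h0 h1
    have hα := mul_pos hC (hL0 α h0 h1)
    have : C * L α * (1 + ((min (I α) (ENNReal.ofReal (C * L α))).toReal / (C * L α) - 1)) =
        (min (I α) (ENNReal.ofReal (C * L α))).toReal := by
      rw [add_sub_cancel, mul_div_cancel₀ _ hα.ne']
    rw [this, ENNReal.ofReal_toReal (ne_top_of_le_ne_top ENNReal.ofReal_ne_top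
      (min_le_right _ _))]
    exact min_le_left _ _

theorem EReal.eventually_le_mul_of_tendsto_div {z : ℕ → EReal} {q b : ℝ} (hqb : q < b)
    (h : Tendsto (fun n : ℕ => z n / (n : EReal)) atTop (𝓝 (q : EReal))) :
    ∀ᶠ n : ℕ in atTop, z n ≤ ((b * n : ℝ) : EReal) := by
  filter_upwards [h.eventually_lt_const (EReal.coe_lt_coe_iff.2 hqb), eventually_gt_atTop 0]
    with n hn hn0
  have h1 := (EReal.div_le_iff_le_mul (by exact_mod_cast hn0) (EReal.natCast_ne_top n)).1 hn.le
  rw [EReal.coe_mul, mul_comm]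
  exact h1

theorem tendsto_abs_log_nhdsGT_zero :
    Tendsto (fun α : ℝ => |Real.log α|) (𝓝[>] 0) atTop :=
  tendsto_abs_atBot_atTop.comp Real.tendsto_log_nhdsGT_zero

namespace RadialModel

variable {Ω : Type*} [mΩ : MeasurableSpace Ω] {P : Measure Ω} {M : ℕ}

/-! ### The law of the observations -/

/-- Density of the observation made by the sensor at `a` when the source is `o m` and the radius
is `r`. -/
noncomputable def obsPdf (𝓜 : RadialModel P M) (m : Fin M) (r : ℕ) (a : Plane) (x : ℝ) : ℝ≥0 :=
  if ‖a - 𝓜.o m‖ < (r : ℝ) then 𝓜.f₁ a (𝓜.o m) x else 𝓜.f₀ x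

/-- The (time, sensor) pairs which deliver an observation up to time `N`. -/
abbrev ObsIndex (𝓜 : RadialModel P M) (N : ℕ) : Type :=
  ↥((Finset.range (N + 1)).sigma 𝓜.A)

/-- All observations up to time `N`, as one random vector. -/
def obs (𝓜 : RadialModel P M) (N : ℕ) (ω : Ω) (p : 𝓜.ObsIndex N) : ℝ :=
  𝓜.X p.1.1 p.1.2 ω

/-- The event that the source is `o m` and that the radius follows the path `r` up to time `N`. -/
def stateEvent (𝓜 : RadialModel P M) (m : Fin M) (r : ℕ → ℕ) (N : ℕ) : Set Ω :=
  {ω | 𝓜.O ω = m ∧ ∀ j ≤ N, 𝓜.R j ω = r j}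

theorem obsIndex_mem (𝓜 : RadialModel P M) {N : ℕ} (p : 𝓜.ObsIndex N) : p.1.2 ∈ 𝓜.A p.1.1 :=
  (Finset.mem_sigma.1 p.2).2

theorem isPdf_obsPdf (𝓜 : RadialModel P M) (m : Fin M) (r : ℕ) {n : ℕ} {a : Plane}
    (ha : a ∈ 𝓜.A n) : IsPdf (𝓜.obsPdf m r a) := by
  unfold obsPdf
  split_ifs
  · exact 𝓜.f₁_pdf a (𝓜.A_subset n ha) m
  · exact 𝓜.f₀_pdf

theorem measurable_obs (𝓜 : RadialModel P M) (N : ℕ) : Measurable (𝓜.obs N) :=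
  measurable_pi_lambda _ fun p => 𝓜.X_measurable p.1.1 p.1.2 (𝓜.obsIndex_mem p)

theorem measurableSet_stateEvent (𝓜 : RadialModel P M) (m : Fin M) (r : ℕ → ℕ) (N : ℕ) :
    MeasurableSet (𝓜.stateEvent m r N) := by
  have : 𝓜.stateEvent m r N = 𝓜.O ⁻¹' {m} ∩ ⋂ j ≤ N, 𝓜.R j ⁻¹' {r j} := by
    ext ω; simp [stateEvent]
  rw [this]
  exact (𝓜.O_measurable (measurableSet_singleton _)).inter
    (MeasurableSet.iInter fun j => MeasurableSet.iInter fun _ =>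
      𝓜.R_measurable j (measurableSet_singleton _))

/-- The information at time `N` is generated by the vector of all observations up to time `N`. -/
theorem exists_preimage_obs (𝓜 : RadialModel P M) {N : ℕ} {E : Set Ω}
    (hE : MeasurableSet[𝓜.info N] E) : ∃ S, MeasurableSet S ∧ 𝓜.obs N ⁻¹' S = E := by
  have hle : (𝓜.info N : MeasurableSpace Ω) ≤ MeasurableSpace.comap (𝓜.obs N) inferInstance := by
    refine iSup₂_le fun j hj => iSup₂_le fun a ha => ?_
    have hp : (⟨j, a⟩ : (_ : ℕ) × Plane) ∈ (Finset.range (N + 1)).sigma 𝓜.A :=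
      Finset.mem_sigma.2 ⟨Finset.mem_range.2 (Nat.lt_succ_of_le ‹_›), ha⟩
    have : 𝓜.X j a = (fun x : 𝓜.ObsIndex N → ℝ => x ⟨⟨j, a⟩, hp⟩) ∘ 𝓜.obs N := rfl
    rw [this, ← MeasurableSpace.comap_comp]
    exact MeasurableSpace.comap_mono (measurable_pi_apply _).comap_le
  exact hle _ hE

theorem prod_obsIndex (𝓜 : RadialModel P M) (N : ℕ) {β : Type*} [CommMonoid β]
    (F : ℕ → Plane → β) :
    ∏ p : 𝓜.ObsIndex N, F p.1.1 p.1.2 = ∏ n ∈ Finset.range (N + 1), ∏ a ∈ 𝓜.A n, F n a := by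
  rw [Finset.prod_sigma']
  exact Finset.prod_coe_sort _ fun p : (_ : ℕ) × Plane => F p.1 p.2

/-- Given the source and the radii, the vector of observations has the product density. This extends
the field `X_law` of the model from rectangles to all measurable sets. -/
theorem measure_stateEvent_inter_obs [IsFiniteMeasure P] (𝓜 : RadialModel P M) (m : Fin M)
    (r : ℕ → ℕ) (N : ℕ) {S : Set (𝓜.ObsIndex N → ℝ)} (hS : MeasurableSet S) :
    P (𝓜.stateEvent m r N ∩ 𝓜.obs N ⁻¹' S) = P (𝓜.stateEvent m r N) *
      ∫⁻ x in S, ∏ p : 𝓜.ObsIndex N, (𝓜.obsPdf m (r p.1.1) p.1.2 (x p) : ℝ≥0∞) := by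
  classical
  set J := 𝓜.stateEvent m r N with hJ
  by_cases h0 : P J = 0
  · rw [h0, zero_mul]
    exact measure_mono_null Set.inter_subset_left h0
  have htop : P J ≠ ∞ := measure_ne_top _ _
  have hpdf : ∀ p : 𝓜.ObsIndex N, IsPdf (𝓜.obsPdf m (r p.1.1) p.1.2) :=
    fun p => 𝓜.isPdf_obsPdf m _ (𝓜.obsIndex_mem p)
  have : ∀ p : 𝓜.ObsIndex N, IsFiniteMeasure
      ((volume : Measure ℝ).withDensity fun x => 𝓜.obsPdf m (r p.1.1) p.1.2 x) := fun p =>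
    isFiniteMeasure_withDensity (by rw [(hpdf p).2]; exact ENNReal.one_ne_top)
  have key : Measure.pi (fun p : 𝓜.ObsIndex N =>
      (volume : Measure ℝ).withDensity fun x => 𝓜.obsPdf m (r p.1.1) p.1.2 x) =
      (P J)⁻¹ • (P.restrict J).map (𝓜.obs N) := by
    refine Measure.pi_eq fun s hs => ?_
    -- sides of the rectangle, extended to pairs (time, location) without an observation
    let B : ℕ → Plane → Set ℝ := fun n a =>
      if h : (⟨n, a⟩ : (_ : ℕ) × Plane) ∈ (Finset.range (N + 1)).sigma 𝓜.A
        then s ⟨⟨n, a⟩, h⟩ else Set.univ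
    have hBs : ∀ p : 𝓜.ObsIndex N, B p.1.1 p.1.2 = s p := fun p => dif_pos p.2
    have hB : ∀ n a, MeasurableSet (B n a) := fun n a => by
      simp only [B]; split_ifs with h
      · exact hs _
      · exact MeasurableSet.univ
    have hlaw := 𝓜.X_law N m r B hB
    have hset : {ω | (𝓜.O ω = m ∧ ∀ j ≤ N, 𝓜.R j ω = r j) ∧
        ∀ n ≤ N, ∀ a ∈ 𝓜.A n, 𝓜.X n a ω ∈ B n a} = 𝓜.obs N ⁻¹' (Set.univ.pi s) ∩ J := by
      ext ω
      rw [Set.inter_comm]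
      refine and_congr Iff.rfl ⟨fun h p _ => ?_, fun h n hn a ha => ?_⟩
      · rw [← hBs p]
        have := Finset.mem_sigma.1 p.2
        exact h _ (by have := Finset.mem_range.1 this.1; omega) _ this.2
      · have hp : (⟨n, a⟩ : (_ : ℕ) × Plane) ∈ (Finset.range (N + 1)).sigma 𝓜.A :=
          Finset.mem_sigma.2 ⟨Finset.mem_range.2 (Nat.lt_succ_of_le ‹_›), ha⟩
        have := h ⟨⟨n, a⟩, hp⟩ trivial
        rw [← hBs] at this
        exact this
    rw [hset] at hlaw
    rw [Measure.smul_apply, Measure.map_apply (𝓜.measurable_obs N) (MeasurableSet.univ_pi hs),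
      Measure.restrict_apply (𝓜.measurable_obs N (MeasurableSet.univ_pi hs)), hlaw, smul_eq_mul,
      ← mul_assoc]
    change (P J)⁻¹ * P J * _ = _
    rw [ENNReal.inv_mul_cancel h0 htop, one_mul]
    refine (𝓜.prod_obsIndex N fun n a =>
      ∫⁻ x in B n a, (𝓜.obsPdf m (r n) a x : ℝ≥0∞)).symm.trans ?_
    refine Finset.prod_congr rfl fun p _ => ?_
    rw [withDensity_apply _ (hs p), hBs p]
  rw [pi_withDensity _ hpdf] at key
  have h1 := congrArg (fun μ => P J * μ S) key
  simp only [withDensity_apply _ hS, Measure.smul_apply, smul_eq_mul] at h1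
  rw [h1, ← mul_assoc, ENNReal.mul_inv_cancel h0 htop, one_mul,
    Measure.map_apply (𝓜.measurable_obs N) hS,
    Measure.restrict_apply (𝓜.measurable_obs N hS), Set.inter_comm]

/-! ### Change of measure -/

/-- The radius path of an event that starts at time `k` and grows by `1` at each step until it
reaches `Rmax`. -/
def path (𝓜 : RadialModel P M) (k j : ℕ) : ℕ :=
  if j < k then 0 else min (j - k + 1) 𝓜.Rmax

theorem norm_sub_lt_Rmax (𝓜 : RadialModel P M) (m : Fin M) {a : Plane} (ha : a ∈ 𝓜.S) :
    ‖a - 𝓜.o m‖ < (𝓜.Rmax : ℝ) :=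
  𝓜.Rmax_isLeast.1 m ha

theorem Rmax_pos (𝓜 : RadialModel P M) (m : Fin M) : 0 < 𝓜.Rmax := by
  have := (norm_nonneg _).trans_lt (𝓜.norm_sub_lt_Rmax m (𝓜.o_mem m))
  exact_mod_cast this

theorem radiusStep_path (𝓜 : RadialModel P M) {k n : ℕ} (hn : k ≤ n) :
    radiusStep 1 𝓜.Rmax (𝓜.path k n) (𝓜.path k (n + 1)) = 1 := by
  have h1 : 𝓜.path k n = min (n - k + 1) 𝓜.Rmax := if_neg (by omega)
  have h2 : 𝓜.path k (n + 1) = min (n - k + 2) 𝓜.Rmax := by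
    rw [path, if_neg (by omega)]; congr 1; omega
  rw [radiusStep, h1, h2]
  rcases le_or_gt 𝓜.Rmax (n - k + 1) with h | h
  · rw [min_eq_right h, min_eq_right (by omega)]; simp
  · rw [min_eq_left h.le, min_eq_left (by omega), if_neg (by omega), if_pos rfl]

/-- The radius path determines the change point, as the radius is `0` strictly before it and `1` at
it. -/
theorem stateEvent_path_eq (𝓜 : RadialModel P M) (m : Fin M) {k n : ℕ} (hn : k ≤ n) :
    𝓜.stateEvent m (𝓜.path k) n =
      {ω | 𝓜.t ω = k ∧ 𝓜.O ω = m ∧ ∀ j ≤ n, 𝓜.R j ω = 𝓜.path k j} := by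
  have hR := 𝓜.Rmax_pos m
  ext ω
  refine ⟨fun h => ⟨?_, h⟩, fun h => h.2⟩
  rcases lt_trichotomy (𝓜.t ω) k with hk | hk | hk
  · have := h.2 (𝓜.t ω) (by omega)
    rw [𝓜.R_at ω, path, if_pos hk] at this
    omega
  · exact hk
  · have := h.2 k hn
    rw [𝓜.R_before ω k hk, path, if_neg (by omega)] at this
    omega

/-- If the radius grows with probability one, then on `{t = k, O = o m}` it almost surely follows the
deterministic path. -/
theorem measure_stateEvent_path (𝓜 : RadialModel P M) (hρ₁ : 𝓜.ρ₁ = 1) (m : Fin M)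
    {k n : ℕ} (hn : k ≤ n) :
    P (𝓜.stateEvent m (𝓜.path k) n) = P {ω | 𝓜.t ω = k ∧ 𝓜.O ω = m} := by
  rw [𝓜.stateEvent_path_eq m hn]
  induction n, hn using Nat.le_induction with
  | base =>
    congr 1
    ext ω
    refine ⟨fun h => ⟨h.1, h.2.1⟩, fun h => ⟨h.1, h.2, fun j hj => ?_⟩⟩
    have hR := 𝓜.Rmax_pos m
    rcases hj.lt_or_eq with hj | rfl
    · rw [𝓜.R_before ω j (by rw [h.1]; exact hj), path, if_pos hj]
    · have h1 := 𝓜.R_at ω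
      rw [h.1] at h1
      rw [h1, path, if_neg (lt_irrefl _)]
      omega
  | succ n hn ih =>
    rw [𝓜.R_step k m (𝓜.path k) n hn, hρ₁, 𝓜.radiusStep_path hn, ENNReal.ofReal_one, one_mul,
      ih]

theorem stateEvent_zero (𝓜 : RadialModel P M) (m : Fin M) (n : ℕ) :
    𝓜.stateEvent m (fun _ => 0) n = {ω | n < 𝓜.t ω ∧ 𝓜.O ω = m} := by
  ext ω
  refine ⟨fun h => ⟨?_, h.1⟩, fun h => ⟨h.2, fun j hj => 𝓜.R_before ω j (hj.trans_lt h.1)⟩⟩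
  by_contra hn
  have := h.2 (𝓜.t ω) (not_lt.1 hn)
  rw [𝓜.R_at ω] at this
  exact one_ne_zero this

theorem measure_le_t [IsProbabilityMeasure P] (𝓜 : RadialModel P M) (n : ℕ) :
    P {ω | n ≤ 𝓜.t ω} = ENNReal.ofReal ((1 - 𝓜.ρ) ^ n) := by
  have h0 := 𝓜.ρ_pos
  have h1 := 𝓜.ρ_lt_one
  induction n with
  | zero => simp
  | succ n ih =>
    have hset : {ω | n + 1 ≤ 𝓜.t ω} = {ω | n ≤ 𝓜.t ω} \ {ω | 𝓜.t ω = n} := by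
      ext ω; simp only [Set.mem_ofPred_eq, Set.mem_sdiff]; omega
    have hsub : {ω | 𝓜.t ω = n} ⊆ {ω | n ≤ 𝓜.t ω} := fun ω h => (show 𝓜.t ω = n from h).ge
    rw [hset, measure_sdiff hsub
      (𝓜.t_measurable (measurableSet_singleton n)).nullMeasurableSet (measure_ne_top _ _), ih,
      𝓜.t_geometric, ← ENNReal.ofReal_sub _ (by have := sub_pos.2 h1; positivity)]
    congr 1; ring

theorem measure_t_mem_inter_O [IsProbabilityMeasure P] (𝓜 : RadialModel P M) (m : Fin M)
    (s : Set ℕ) :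
    P {ω | 𝓜.t ω ∈ s ∧ 𝓜.O ω = m} = P {ω | 𝓜.t ω ∈ s} * ENNReal.ofReal (1 / (M : ℝ)) := by
  rw [← 𝓜.O_uniform m]
  exact 𝓜.t_indep_O.measure_inter_preimage_eq_mul s {m} (MeasurableSet.of_discrete)
    (measurableSet_singleton m)

theorem measure_t_eq_inter_O [IsProbabilityMeasure P] (𝓜 : RadialModel P M) (m : Fin M) (k : ℕ) :
    P {ω | 𝓜.t ω = k ∧ 𝓜.O ω = m} = ENNReal.ofReal (𝓜.ρ * (1 - 𝓜.ρ) ^ k / M) := by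
  have h := 𝓜.measure_t_mem_inter_O m {k}
  simp only [Set.mem_singleton_iff] at h
  have h1 := sub_pos.2 𝓜.ρ_lt_one
  have h0 := 𝓜.ρ_pos
  rw [h, 𝓜.t_geometric, ← ENNReal.ofReal_mul (by positivity)]
  congr 1; ring

/-- The joint density along the deterministic path is `jointPdf₁`. The cap `Rmax` of the path does
not matter, as every sensor is closer than `Rmax` to every source. -/
theorem prod_obsPdf_path (𝓜 : RadialModel P M) (m : Fin M) {k i : ℕ} (hi : k ≤ i)
    (x : Plane → ℝ) :
    ∏ a ∈ 𝓜.A i, 𝓜.obsPdf m (𝓜.path k i) a (x a) = 𝓜.jointPdf₁ k m i x := by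
  classical
  have hη : 𝓜.η i k m = {a ∈ 𝓜.A i | ‖a - 𝓜.o m‖ < (i : ℝ) - k + 1} := by
    ext a; simp [η]
  have hsd : 𝓜.A i \ 𝓜.η i k m = {a ∈ 𝓜.A i | ¬ ‖a - 𝓜.o m‖ < (i : ℝ) - k + 1} := by
    rw [hη, Finset.filter_not]
  have hj : 𝓜.jointPdf₁ k m i x = (∏ a ∈ 𝓜.η i k m, 𝓜.f₁ a (𝓜.o m) (x a)) *
      ∏ a ∈ 𝓜.A i \ 𝓜.η i k m, 𝓜.f₀ (x a) := by
    unfold jointPdf₁; congr!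
  rw [hj, hsd, hη, ← Finset.prod_ite]
  refine Finset.prod_congr rfl fun a ha => ?_
  have h1 := 𝓜.norm_sub_lt_Rmax m (𝓜.A_subset i ha)
  unfold obsPdf
  refine if_congr ?_ rfl rfl
  rw [path, if_neg (by omega)]
  push_cast [Nat.cast_sub hi]
  rw [lt_min_iff]
  exact and_iff_left h1

theorem prod_obsPdf_zero (𝓜 : RadialModel P M) (m : Fin M) (i : ℕ) (x : Plane → ℝ) :
    ∏ a ∈ 𝓜.A i, 𝓜.obsPdf m 0 a (x a) = 𝓜.jointPdf₀ i x := by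
  unfold jointPdf₀
  refine Finset.prod_congr rfl fun a _ => if_neg ?_
  simp

theorem prod_obsPdf_le_of_Z_le (𝓜 : RadialModel P M) {k n : ℕ} (hn : k ≤ n) (m : Fin M) {a : ℝ}
    {ω : Ω} (hZ : 𝓜.Z k m n ω ≤ a) :
    ∏ p : 𝓜.ObsIndex n, (𝓜.obsPdf m (𝓜.path k p.1.1) p.1.2 (𝓜.obs n ω p) : ℝ≥0∞) ≤
      ENNReal.ofReal (Real.exp a) *
        ∏ p : 𝓜.ObsIndex n, (𝓜.obsPdf m 0 p.1.2 (𝓜.obs n ω p) : ℝ≥0∞) := by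
  rw [Z, sum_log_eq_log_prod, ← EReal.log_exp (a : EReal), ENNReal.log_le_log_iff,
    EReal.exp_coe] at hZ
  have h1 := prod_le_mul_prod_of_prod_div_le _ _ _ ENNReal.ofReal_ne_top hZ
  have e1 := 𝓜.prod_obsIndex n fun i a => (𝓜.obsPdf m (𝓜.path k i) a (𝓜.X i a ω) : ℝ≥0∞)
  have e0 := 𝓜.prod_obsIndex n fun i a => (𝓜.obsPdf m 0 a (𝓜.X i a ω) : ℝ≥0∞)
  have c1 : ∀ i, ∏ a ∈ 𝓜.A i, (𝓜.obsPdf m 0 a (𝓜.X i a ω) : ℝ≥0∞) =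
      (𝓜.jointPdf₀ i fun a => 𝓜.X i a ω : ℝ≥0∞) := fun i => by
    rw [← 𝓜.prod_obsPdf_zero m, ENNReal.ofNNReal_finsetProd]
  change ∏ p : 𝓜.ObsIndex n, (𝓜.obsPdf m (𝓜.path k p.1.1) p.1.2 (𝓜.X p.1.1 p.1.2 ω) : ℝ≥0∞) ≤
      ENNReal.ofReal (Real.exp a) *
        ∏ p : 𝓜.ObsIndex n, (𝓜.obsPdf m 0 p.1.2 (𝓜.X p.1.1 p.1.2 ω) : ℝ≥0∞)
  rw [e1, e0, Finset.range_eq_Ico,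
    ← Finset.prod_Ico_consecutive _ (Nat.zero_le k) (by omega : k ≤ n + 1),
    ← Finset.prod_Ico_consecutive _ (Nat.zero_le k) (by omega : k ≤ n + 1)]
  have hI : Finset.Ico k (n + 1) = Finset.Icc k n := by ext; simp
  rw [hI]
  simp only [c1]
  have p1 : ∏ i ∈ Finset.Ico 0 k, ∏ a ∈ 𝓜.A i,
      (𝓜.obsPdf m (𝓜.path k i) a (𝓜.X i a ω) : ℝ≥0∞) =
      ∏ i ∈ Finset.Ico 0 k, (𝓜.jointPdf₀ i fun a => 𝓜.X i a ω : ℝ≥0∞) :=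
    Finset.prod_congr rfl fun i hi => by
      rw [← c1 i, path, if_pos (Finset.mem_Ico.1 hi).2]
  have p2 : ∏ i ∈ Finset.Icc k n, ∏ a ∈ 𝓜.A i,
      (𝓜.obsPdf m (𝓜.path k i) a (𝓜.X i a ω) : ℝ≥0∞) =
      ∏ i ∈ Finset.Icc k n, (𝓜.jointPdf₁ k m i fun a => 𝓜.X i a ω : ℝ≥0∞) :=
    Finset.prod_congr rfl fun i hi => by
      rw [← 𝓜.prod_obsPdf_path m (Finset.mem_Icc.1 hi).1, ENNReal.ofNNReal_finsetProd]
  rw [p1, p2, mul_left_comm]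
  gcongr

/-- Change of measure from `{t = k, O = o m}` to `{n < t}`, on the event that the log-likelihood ratio
is at most `a`. The factor is the likelihood ratio `exp a` times the ratio of the prior
probabilities `P (t = k)` and `P (n < t)`. -/
theorem measure_change_point_inter_Z_le [IsProbabilityMeasure P] (𝓜 : RadialModel P M)
    (hρ₁ : 𝓜.ρ₁ = 1) {k n : ℕ} (hn : k ≤ n) (m : Fin M) (a : ℝ) {E : Set Ω}
    (hE : MeasurableSet[𝓜.info n] E) :
    P ({ω | 𝓜.t ω = k ∧ 𝓜.O ω = m} ∩ (E ∩ {ω | 𝓜.Z k m n ω ≤ a})) ≤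
      ENNReal.ofReal (Real.exp a * (𝓜.ρ * (1 - 𝓜.ρ) ^ k / (1 - 𝓜.ρ) ^ (n + 1))) *
        P ({ω | n < 𝓜.t ω} ∩ E) := by
  have hρ0 := 𝓜.ρ_pos
  have hρ1 := sub_pos.2 𝓜.ρ_lt_one
  have hM : (0 : ℝ) < M := by exact_mod_cast (Nat.zero_le _).trans_lt m.2
  obtain ⟨S, hS, rfl⟩ := 𝓜.exists_preimage_obs hE
  let g₁ : (𝓜.ObsIndex n → ℝ) → ℝ≥0∞ := fun x =>
    ∏ p : 𝓜.ObsIndex n, (𝓜.obsPdf m (𝓜.path k p.1.1) p.1.2 (x p) : ℝ≥0∞)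
  let g₀ : (𝓜.ObsIndex n → ℝ) → ℝ≥0∞ := fun x =>
    ∏ p : 𝓜.ObsIndex n, (𝓜.obsPdf m 0 p.1.2 (x p) : ℝ≥0∞)
  have hg : ∀ r : ℕ → ℕ, Measurable fun x : 𝓜.ObsIndex n → ℝ =>
      ∏ p : 𝓜.ObsIndex n, (𝓜.obsPdf m (r p.1.1) p.1.2 (x p) : ℝ≥0∞) := fun r =>
    Finset.measurable_prod _ fun p _ =>
      ((𝓜.isPdf_obsPdf m _ (𝓜.obsIndex_mem p)).1.comp (measurable_pi_apply p)).coe_nnreal_ennreal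
  have hg₁ : Measurable g₁ := hg (𝓜.path k)
  have hg₀ : Measurable g₀ := hg fun _ => 0
  let c := ENNReal.ofReal (Real.exp a)
  -- the region where the likelihood ratio is at most `exp a`
  let D : Set (𝓜.ObsIndex n → ℝ) := {x | g₁ x ≤ c * g₀ x}
  have hD : MeasurableSet D := measurableSet_le hg₁ (hg₀.const_mul _)
  set J₁ := 𝓜.stateEvent m (𝓜.path k) n with hJ₁
  set J₀ := 𝓜.stateEvent m (fun _ => 0) n with hJ₀
  have hPJ₁ := 𝓜.measure_stateEvent_path hρ₁ m hn
  rw [𝓜.measure_t_eq_inter_O] at hPJ₁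
  have hPJ₀ : P J₀ = ENNReal.ofReal ((1 - 𝓜.ρ) ^ (n + 1) / M) := by
    have h := 𝓜.measure_t_mem_inter_O m (Set.Ici (n + 1))
    simp only [Set.mem_Ici, 𝓜.measure_le_t] at h
    rw [hJ₀, stateEvent_zero]
    refine h.trans ?_
    rw [← ENNReal.ofReal_mul (by positivity)]
    congr 1; ring
  have hae : ∀ᵐ ω ∂P, ω ∈ {ω | 𝓜.t ω = k ∧ 𝓜.O ω = m} → ω ∈ J₁ := by
    refine (ae_le_set (μ := P) (s := {ω | 𝓜.t ω = k ∧ 𝓜.O ω = m}) (t := J₁)).2 ?_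
    rw [measure_sdiff _ (𝓜.measurableSet_stateEvent m _ n).nullMeasurableSet (measure_ne_top _ _),
      𝓜.measure_stateEvent_path hρ₁ m hn, tsub_self]
    rw [𝓜.stateEvent_path_eq m hn]
    exact fun ω h => ⟨h.1, h.2.1⟩
  calc P ({ω | 𝓜.t ω = k ∧ 𝓜.O ω = m} ∩ (𝓜.obs n ⁻¹' S ∩ {ω | 𝓜.Z k m n ω ≤ a}))
      ≤ P (J₁ ∩ 𝓜.obs n ⁻¹' (S ∩ D)) := by
        refine measure_mono_ae ?_
        filter_upwards [hae] with ω hω h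
        exact ⟨hω h.1, h.2.1, 𝓜.prod_obsPdf_le_of_Z_le hn m h.2.2⟩
    _ = P J₁ * ∫⁻ x in S ∩ D, g₁ x := 𝓜.measure_stateEvent_inter_obs m _ n (hS.inter hD)
    _ ≤ P J₁ * ∫⁻ x in S, c * g₀ x := by
        refine mul_le_mul' le_rfl ?_
        calc ∫⁻ x in S ∩ D, g₁ x ≤ ∫⁻ x in S ∩ D, c * g₀ x :=
              setLIntegral_mono (hg₀.const_mul _) fun x hx => hx.2
          _ ≤ ∫⁻ x in S, c * g₀ x := lintegral_mono_set Set.inter_subset_left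
    _ = ENNReal.ofReal (Real.exp a * (𝓜.ρ * (1 - 𝓜.ρ) ^ k / (1 - 𝓜.ρ) ^ (n + 1))) *
          (P J₀ * ∫⁻ x in S, g₀ x) := by
        rw [lintegral_const_mul _ hg₀, hPJ₁, hPJ₀, ← mul_assoc, ← mul_assoc,
          ← ENNReal.ofReal_mul (by positivity), ← ENNReal.ofReal_mul (by positivity)]
        congr 2
        field_simp
    _ = ENNReal.ofReal (Real.exp a * (𝓜.ρ * (1 - 𝓜.ρ) ^ k / (1 - 𝓜.ρ) ^ (n + 1))) *
          P (J₀ ∩ 𝓜.obs n ⁻¹' S) := by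
        rw [𝓜.measure_stateEvent_inter_obs m _ n hS]
    _ ≤ _ := by
        gcongr
        rw [hJ₀, stateEvent_zero]
        exact fun ω h => h.1

/-! ### Typical growth of the log-likelihood ratio -/

/-- The event that the change point is `k` and the source is `o m`. -/
def changeEvent (𝓜 : RadialModel P M) (k : ℕ) (m : Fin M) : Set Ω :=
  {ω | 𝓜.t ω = k ∧ 𝓜.O ω = m}

theorem measurableSet_changeEvent (𝓜 : RadialModel P M) (k : ℕ) (m : Fin M) :
    MeasurableSet (𝓜.changeEvent k m) :=
  (𝓜.t_measurable (measurableSet_singleton k)).inter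
    (𝓜.O_measurable (measurableSet_singleton m))

theorem measureReal_changeEvent [IsProbabilityMeasure P] (𝓜 : RadialModel P M) (k : ℕ)
    (m : Fin M) : P.real (𝓜.changeEvent k m) = 𝓜.ρ * (1 - 𝓜.ρ) ^ k / M := by
  have h0 := 𝓜.ρ_pos
  have h1 := sub_pos.2 𝓜.ρ_lt_one
  rw [measureReal_def, changeEvent, 𝓜.measure_t_eq_inter_O, ENNReal.toReal_ofReal (by positivity)]

theorem measurable_Z (𝓜 : RadialModel P M) (k : ℕ) (m : Fin M) (n : ℕ) :
    Measurable (𝓜.Z k m n) := by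
  classical
  have h : 𝓜.Z k m n = fun ω => ENNReal.log (∏ i ∈ Finset.Icc k n,
      ((𝓜.jointPdf₁ k m i (fun a => 𝓜.X i a ω) : ℝ≥0∞) /
        (𝓜.jointPdf₀ i (fun a => 𝓜.X i a ω) : ℝ≥0∞))) := by
    ext ω
    exact sum_log_eq_log_prod _ _
  rw [h]
  refine Measurable.ennreal_log (Finset.measurable_prod _ fun i hi => Measurable.div ?_ ?_)
  · refine Measurable.coe_nnreal_ennreal ?_
    simp only [← 𝓜.prod_obsPdf_path m (Finset.mem_Icc.1 hi).1]
    exact Finset.measurable_prod _ fun a ha =>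
      (𝓜.isPdf_obsPdf m _ ha).1.comp (𝓜.X_measurable i a ha)
  · refine Measurable.coe_nnreal_ennreal ?_
    exact Finset.measurable_prod _ fun a ha => 𝓜.f₀_pdf.1.comp (𝓜.X_measurable i a ha)

/-- On `{t = k, O = o m}` the log-likelihood ratio is unlikely to exceed a line of slope larger than
its growth rate. -/
theorem tendsto_measureReal_Z_gt [IsProbabilityMeasure P] (𝓜 : RadialModel P M) {k : ℕ}
    {m : Fin M} {q b : ℝ} (hqb : q < b)
    (hZ : ∀ᵐ ω ∂P, 𝓜.t ω = k → 𝓜.O ω = m →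
      Tendsto (fun n : ℕ => 𝓜.Z k m (k + n) ω / (n : EReal)) atTop (𝓝 (q : EReal))) :
    Tendsto (fun n : ℕ => P.real
      (𝓜.changeEvent k m ∩ {ω | ((b * n : ℝ) : EReal) < 𝓜.Z k m (k + n) ω})) atTop (𝓝 0) := by
  have h := tendsto_measure_of_ae_tendsto_indicator_of_isFiniteMeasure atTop (μ := P)
    (A := ∅) (As := fun n : ℕ => 𝓜.changeEvent k m ∩
      {ω | ((b * n : ℝ) : EReal) < 𝓜.Z k m (k + n) ω}) MeasurableSet.empty
    (fun n => (𝓜.measurableSet_changeEvent k m).inter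
      (measurableSet_lt measurable_const (𝓜.measurable_Z k m _))) ?_
  · rw [measure_empty] at h
    exact (ENNReal.tendsto_toReal ENNReal.zero_ne_top).comp h
  · filter_upwards [hZ] with ω hω
    by_cases hA : ω ∈ 𝓜.changeEvent k m
    · filter_upwards [EReal.eventually_le_mul_of_tendsto_div hqb (hω hA.1 hA.2)] with n hn
      exact iff_of_false (fun h' => (not_lt.2 hn) h'.2) (Set.notMem_empty _)
    · exact Eventually.of_forall fun n => iff_of_false (fun h' => hA h'.1) (Set.notMem_empty _)

theorem measureReal_change_point_inter_Z_le [IsProbabilityMeasure P] (𝓜 : RadialModel P M)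
    (hρ₁ : 𝓜.ρ₁ = 1) (k n : ℕ) (m : Fin M) (a : ℝ) {E : Set Ω}
    (hE : MeasurableSet[𝓜.info (k + n)] E) {β : ℝ} (hβ0 : 0 ≤ β)
    (hβ : P ({ω | k + n < 𝓜.t ω} ∩ E) ≤ ENNReal.ofReal β) :
    P.real (𝓜.changeEvent k m ∩ (E ∩ {ω | 𝓜.Z k m (k + n) ω ≤ a})) ≤
      Real.exp a * (𝓜.ρ / (1 - 𝓜.ρ) ^ (n + 1)) * β := by
  have h0 := 𝓜.ρ_pos
  have h1 := sub_pos.2 𝓜.ρ_lt_one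
  refine ENNReal.toReal_le_of_le_ofReal (by positivity) ?_
  refine (𝓜.measure_change_point_inter_Z_le hρ₁ (Nat.le_add_right k n) m a hE).trans ?_
  rw [ENNReal.ofReal_mul (p := Real.exp a * _) (by positivity)]
  refine mul_le_mul' (le_of_eq ?_) hβ
  congr 2
  rw [add_assoc, pow_add]
  field_simp

/-- The log-likelihood ratio of the true law against another one cannot decrease linearly. -/
theorem limit_nonneg [IsProbabilityMeasure P] (𝓜 : RadialModel P M) (hρ₁ : 𝓜.ρ₁ = 1)
    {m : Fin M} {q : ℝ}
    (hZ : ∀ᵐ ω ∂P, 𝓜.t ω = 0 → 𝓜.O ω = m →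
      Tendsto (fun n : ℕ => 𝓜.Z 0 m (0 + n) ω / (n : EReal)) atTop (𝓝 (q : EReal))) :
    0 ≤ q := by
  by_contra hq
  push Not at hq
  have h0 := 𝓜.ρ_pos
  have h1 := sub_pos.2 𝓜.ρ_lt_one
  have hM : (0 : ℝ) < M := by exact_mod_cast (Nat.zero_le _).trans_lt m.2
  have hlim := 𝓜.tendsto_measureReal_Z_gt (b := q / 2) (by linarith) hZ
  have hexp : Tendsto (fun n : ℕ => Real.exp (q / 2 * n) * 𝓜.ρ) atTop (𝓝 0) := by
    have : Tendsto (fun n : ℕ => q / 2 * (n : ℝ)) atTop atBot :=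
      tendsto_natCast_atTop_atTop.const_mul_atTop_of_neg (by linarith)
    simpa using (Real.tendsto_exp_atBot.comp this).mul_const 𝓜.ρ
  have hle : ∀ n : ℕ, 𝓜.ρ / M ≤ P.real (𝓜.changeEvent 0 m ∩
      {ω | ((q / 2 * n : ℝ) : EReal) < 𝓜.Z 0 m (0 + n) ω}) + Real.exp (q / 2 * n) * 𝓜.ρ := by
    intro n
    have hβ : P ({ω | 0 + n < 𝓜.t ω} ∩ Set.univ) ≤ ENNReal.ofReal ((1 - 𝓜.ρ) ^ (n + 1)) := by
      rw [← 𝓜.measure_le_t (n + 1), Set.inter_univ, zero_add]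
      exact le_rfl
    have h2 := 𝓜.measureReal_change_point_inter_Z_le hρ₁ 0 n m (q / 2 * n) MeasurableSet.univ
      (by positivity) hβ
    -- the probability of `n < t` cancels the ratio of the priors, so `exp` of a negative
    -- multiple of `n` is left
    rw [mul_assoc, div_mul_cancel₀ _ (by positivity)] at h2
    have h3 := 𝓜.measureReal_changeEvent 0 m
    rw [pow_zero, mul_one] at h3
    rw [← h3]
    refine le_trans (measureReal_mono ?_) ((measureReal_union_le _ _).trans
      (add_le_add_right h2 _))
    intro ω hω
    rcases lt_or_ge ((q / 2 * n : ℝ) : EReal) (𝓜.Z 0 m (0 + n) ω) with h | h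
    · exact Or.inl ⟨hω, h⟩
    · exact Or.inr ⟨hω, trivial, h⟩
  have := ge_of_tendsto' (hlim.add hexp) hle
  have h4 : 0 < 𝓜.ρ / M := by positivity
  linarith

/-- A procedure of level `α` runs for more than `n` time slots after the change, up to the
probability that the log-likelihood ratio is atypically large and an error proportional to `α`. -/
theorem measureReal_changeEvent_sub_le [IsProbabilityMeasure P] (𝓜 : RadialModel P M)
    (hρ₁ : 𝓜.ρ₁ = 1) {α : ℝ} (hα : 0 < α) {T : Ω → ℕ∞} (hT : T ∈ 𝓜.Δ α) (k n : ℕ) (m : Fin M)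
    (a : ℝ) :
    P.real (𝓜.changeEvent k m) -
        (P.real (𝓜.changeEvent k m ∩ {ω | (a : EReal) < 𝓜.Z k m (k + n) ω}) +
        Real.exp a * (𝓜.ρ / (1 - 𝓜.ρ) ^ (n + 1)) * α) ≤
      P.real (𝓜.changeEvent k m ∩ {ω | ((k + n : ℕ) : ℕ∞) < T ω}) := by
  have hE : MeasurableSet[𝓜.info (k + n)] {ω | T ω ≤ ((k + n : ℕ) : ℕ∞)} := hT.1 (k + n)
  have hβ : P ({ω | k + n < 𝓜.t ω} ∩ {ω | T ω ≤ ((k + n : ℕ) : ℕ∞)}) ≤ ENNReal.ofReal α := by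
    refine le_trans (measure_mono fun ω hω => ?_) hT.2
    have h1 : k + n < 𝓜.t ω := hω.1
    have h2 : T ω ≤ ((k + n : ℕ) : ℕ∞) := hω.2
    exact h2.trans_lt (Nat.cast_lt.2 h1)
  have h2 := 𝓜.measureReal_change_point_inter_Z_le hρ₁ k n m a hE hα.le hβ
  have hcov : 𝓜.changeEvent k m ⊆ (𝓜.changeEvent k m ∩ {ω | ((k + n : ℕ) : ℕ∞) < T ω}) ∪
      ((𝓜.changeEvent k m ∩ {ω | (a : EReal) < 𝓜.Z k m (k + n) ω}) ∪
      (𝓜.changeEvent k m ∩ ({ω | T ω ≤ ((k + n : ℕ) : ℕ∞)} ∩ {ω | 𝓜.Z k m (k + n) ω ≤ a}))) := by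
    intro ω hω
    rcases lt_or_ge ((k + n : ℕ) : ℕ∞) (T ω) with h | h
    · exact Or.inl ⟨hω, h⟩
    rcases lt_or_ge (a : EReal) (𝓜.Z k m (k + n) ω) with h' | h'
    · exact Or.inr (Or.inl ⟨hω, h'⟩)
    · exact Or.inr (Or.inr ⟨hω, h, h'⟩)
  have h3 := (measureReal_mono (μ := P) hcov).trans (measureReal_union_le _ _)
  have h4 := measureReal_union_le (μ := P)
    (𝓜.changeEvent k m ∩ {ω | (a : EReal) < 𝓜.Z k m (k + n) ω})
    (𝓜.changeEvent k m ∩ ({ω | T ω ≤ ((k + n : ℕ) : ℕ∞)} ∩ {ω | 𝓜.Z k m (k + n) ω ≤ a}))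
  linarith

/-- Lower bound for the average detection delay through the probabilities that the delay exceeds
`N m`, when the change occurs before time `K`. -/
theorem ofReal_sum_le_ADD [IsProbabilityMeasure P] (𝓜 : RadialModel P M) {T : Ω → ℕ∞}
    (hT : IsStoppingTime 𝓜.info T) (K : ℕ) (N : Fin M → ℕ) :
    ENNReal.ofReal (∑ p ∈ Finset.range K ×ˢ Finset.univ, (N p.2 : ℝ) *
      P.real (𝓜.changeEvent p.1 p.2 ∩ {ω | ((p.1 + N p.2 : ℕ) : ℕ∞) < T ω})) ≤ 𝓜.ADD T := by
  let S : ℕ × Fin M → Set Ω := fun p =>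
    𝓜.changeEvent p.1 p.2 ∩ {ω | ((p.1 + N p.2 : ℕ) : ℕ∞) < T ω}
  have hS : ∀ p, MeasurableSet (S p) := fun p => by
    refine (𝓜.measurableSet_changeEvent p.1 p.2).inter ?_
    have h : MeasurableSet {ω | T ω ≤ ((p.1 + N p.2 : ℕ) : ℕ∞)} :=
      𝓜.info.le _ _ (hT (p.1 + N p.2))
    convert h.compl using 1
    ext ω
    simp
  have hdisj : Set.PairwiseDisjoint (↑(Finset.range K ×ˢ (Finset.univ : Finset (Fin M)))) S := by
    intro p _ p' _ hne
    refine Set.disjoint_left.2 fun ω h h' => hne ?_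
    exact Prod.ext (h.1.1.symm.trans h'.1.1) (h.1.2.symm.trans h'.1.2)
  rw [ENNReal.ofReal_sum_of_nonneg fun p _ => by positivity]
  calc ∑ p ∈ Finset.range K ×ˢ Finset.univ, ENNReal.ofReal ((N p.2 : ℝ) * P.real (S p))
      ≤ ∑ p ∈ Finset.range K ×ˢ Finset.univ,
          ∫⁻ ω in S p, ((T ω - (𝓜.t ω : ℕ∞) : ℕ∞) : ℝ≥0∞) ∂P := by
        refine Finset.sum_le_sum fun p _ => ?_
        rw [ENNReal.ofReal_mul (Nat.cast_nonneg _), ENNReal.ofReal_natCast, ofReal_measureReal,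
          ← setLIntegral_const]
        refine setLIntegral_mono' (hS p) fun ω hω => ?_
        have h1 : (p.1 : ℕ∞) + N p.2 ≤ T ω := by exact_mod_cast hω.2.le
        have h2 : (N p.2 : ℕ∞) ≤ T ω - (𝓜.t ω : ℕ∞) := by
          rw [hω.1.1]
          exact (ENat.addLECancellable_natCast _).le_tsub_of_add_le_left h1
        exact_mod_cast ENat.toENNReal_le.2 h2
    _ = ∫⁻ ω in ⋃ p ∈ Finset.range K ×ˢ Finset.univ, S p,
          ((T ω - (𝓜.t ω : ℕ∞) : ℕ∞) : ℝ≥0∞) ∂P :=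
        (lintegral_biUnion_finset hdisj (fun p _ => hS p) _).symm
    _ ≤ 𝓜.ADD T := setLIntegral_le_lintegral _ _

/-! ### Asymptotics of the detection delay -/

theorem abs_log_one_sub_pos (𝓜 : RadialModel P M) : 0 < |Real.log (1 - 𝓜.ρ)| :=
  abs_pos.2 (Real.log_neg (sub_pos.2 𝓜.ρ_lt_one) (by linarith [𝓜.ρ_pos])).ne

/-- A fraction `1 - e` of the optimal delay at the level `α`, when the source is known and the
log-likelihood ratio grows at rate `q`. -/
noncomputable def delay (𝓜 : RadialModel P M) (e q α : ℝ) : ℕ :=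
  ⌊(1 - e) / (q + |Real.log (1 - 𝓜.ρ)|) * |Real.log α|⌋₊

/-- Bound for the probability that a procedure with false alarm probability `α` stops within the
first `𝓜.delay e q α` time slots after the change point `k`, the source being `o m`. The threshold
for the log-likelihood ratio has the slope `q + e * (q + |log (1 - ρ)|)`, which exceeds `q` but not
so much as to outweigh the factor `1 - e` in the delay. -/
noncomputable def earlyBound (𝓜 : RadialModel P M) (k : ℕ) (m : Fin M) (e q α : ℝ) : ℝ :=
  P.real (𝓜.changeEvent k m ∩
    {ω | (((q + e * (q + |Real.log (1 - 𝓜.ρ)|)) * 𝓜.delay e q α : ℝ) : EReal) <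
      𝓜.Z k m (k + 𝓜.delay e q α) ω}) +
  Real.exp ((q + e * (q + |Real.log (1 - 𝓜.ρ)|)) * 𝓜.delay e q α) *
    (𝓜.ρ / (1 - 𝓜.ρ) ^ (𝓜.delay e q α + 1)) * α

theorem tendsto_delay_div (𝓜 : RadialModel P M) {e q : ℝ} (he1 : e < 1) (hq : 0 ≤ q) :
    Tendsto (fun α => (𝓜.delay e q α : ℝ) / |Real.log α|) (𝓝[>] 0)
      (𝓝 ((1 - e) / (q + |Real.log (1 - 𝓜.ρ)|))) := by
  have hd := 𝓜.abs_log_one_sub_pos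
  exact (tendsto_nat_floor_mul_div_atTop (div_nonneg (by linarith) (by linarith))).comp
    tendsto_abs_log_nhdsGT_zero

theorem tendsto_delay_atTop (𝓜 : RadialModel P M) {e q : ℝ} (he1 : e < 1) (hq : 0 ≤ q) :
    Tendsto (𝓜.delay e q) (𝓝[>] 0) atTop := by
  have hd := 𝓜.abs_log_one_sub_pos
  exact tendsto_nat_floor_atTop.comp
    (tendsto_abs_log_nhdsGT_zero.const_mul_atTop (div_pos (by linarith) (by linarith)))

/-- With `d = |log (1 - ρ)|` and `L = |log α|`, the exponent on the left is
`(1 + e) * (q + d) * delay + d - L`, and `(1 + e) * (1 - e) - 1 = - e ^ 2`. -/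
theorem exp_mul_false_alarm_le (𝓜 : RadialModel P M) {e q α : ℝ} (he0 : 0 < e) (he1 : e < 1)
    (hq : 0 ≤ q) (hα0 : 0 < α) (hα1 : α < 1) :
    Real.exp ((q + e * (q + |Real.log (1 - 𝓜.ρ)|)) * 𝓜.delay e q α) *
      (𝓜.ρ / (1 - 𝓜.ρ) ^ (𝓜.delay e q α + 1)) * α ≤
    Real.exp (|Real.log (1 - 𝓜.ρ)| - e ^ 2 * |Real.log α|) := by
  have hd := 𝓜.abs_log_one_sub_pos
  have h1 := sub_pos.2 𝓜.ρ_lt_one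
  have hlog : Real.log (1 - 𝓜.ρ) < 0 := Real.log_neg h1 (by linarith [𝓜.ρ_pos])
  have hρ : 1 - 𝓜.ρ = Real.exp (-|Real.log (1 - 𝓜.ρ)|) := by
    rw [abs_of_neg hlog, neg_neg, Real.exp_log h1]
  have hα : α = Real.exp (-|Real.log α|) := by
    rw [abs_of_neg (Real.log_neg hα0 hα1), neg_neg, Real.exp_log hα0]
  have hN : (𝓜.delay e q α : ℝ) ≤
      (1 - e) / (q + |Real.log (1 - 𝓜.ρ)|) * |Real.log α| :=
    Nat.floor_le (mul_nonneg (div_nonneg (by linarith) (by linarith)) (abs_nonneg _))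
  set N := 𝓜.delay e q α
  set d := |Real.log (1 - 𝓜.ρ)|
  set L := |Real.log α|
  have hqd : 0 < q + d := by linarith
  have hN' : (q + d) * N ≤ (1 - e) * L := by
    rw [div_mul_eq_mul_div, le_div_iff₀ hqd] at hN
    linarith
  calc Real.exp ((q + e * (q + d)) * N) * (𝓜.ρ / (1 - 𝓜.ρ) ^ (N + 1)) * α
      ≤ Real.exp ((q + e * (q + d)) * N) * (1 / (1 - 𝓜.ρ) ^ (N + 1)) * α := by
        gcongr
        exact 𝓜.ρ_lt_one.le
    _ = Real.exp ((q + e * (q + d)) * N + ((N + 1 : ℕ) * d) - L) := by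
        rw [hρ, ← Real.exp_nat_mul, one_div, ← Real.exp_neg, ← Real.exp_add]
        nth_rw 1 [hα]
        rw [← Real.exp_add]
        congr 1; ring
    _ ≤ Real.exp (d - e ^ 2 * L) := by
        apply Real.exp_le_exp.2
        push_cast
        nlinarith [mul_le_mul_of_nonneg_left hN' (by linarith : 0 ≤ 1 + e)]

theorem tendsto_earlyBound [IsProbabilityMeasure P] (𝓜 : RadialModel P M) {k : ℕ} {m : Fin M}
    {e q : ℝ} (he0 : 0 < e) (he1 : e < 1) (hq : 0 ≤ q)
    (hZ : ∀ᵐ ω ∂P, 𝓜.t ω = k → 𝓜.O ω = m →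
      Tendsto (fun n : ℕ => 𝓜.Z k m (k + n) ω / (n : EReal)) atTop (𝓝 (q : EReal))) :
    Tendsto (𝓜.earlyBound k m e q) (𝓝[>] 0) (𝓝 0) := by
  have hd := 𝓜.abs_log_one_sub_pos
  have hρ := sub_pos.2 𝓜.ρ_lt_one
  have h0 := 𝓜.ρ_pos
  have hb : q < q + e * (q + |Real.log (1 - 𝓜.ρ)|) := by
    have : 0 < e * (q + |Real.log (1 - 𝓜.ρ)|) := by positivity
    linarith
  have h1 := (𝓜.tendsto_measureReal_Z_gt hb hZ).comp (𝓜.tendsto_delay_atTop he1 hq)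
  have h2 : Tendsto (fun α : ℝ => Real.exp (|Real.log (1 - 𝓜.ρ)| - e ^ 2 * |Real.log α|))
      (𝓝[>] 0) (𝓝 0) := by
    refine Real.tendsto_exp_atBot.comp (tendsto_atBot_add_const_left _ _ ?_)
    exact tendsto_neg_atTop_atBot.comp
      (tendsto_abs_log_nhdsGT_zero.const_mul_atTop (by positivity))
  have h3 : Tendsto (fun α : ℝ => Real.exp ((q + e * (q + |Real.log (1 - 𝓜.ρ)|)) *
      𝓜.delay e q α) * (𝓜.ρ / (1 - 𝓜.ρ) ^ (𝓜.delay e q α + 1)) * α) (𝓝[>] 0) (𝓝 0) := by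
    refine tendsto_of_tendsto_of_tendsto_of_le_of_le' tendsto_const_nhds h2 ?_ ?_ <;>
      filter_upwards [Ioo_mem_nhdsGT (zero_lt_one (α := ℝ))] with α hα
    · have := hα.1
      positivity
    · exact 𝓜.exp_mul_false_alarm_le he0 he1 hq hα.1 hα.2
  have h := h1.add h3
  rw [add_zero] at h
  exact h

theorem eventually_le_iInf_ADD [IsProbabilityMeasure P] (𝓜 : RadialModel P M)
    (hρ₁ : 𝓜.ρ₁ = 1) {q : Fin M → ℝ} (hq : ∀ m, 0 ≤ q m)
    (hZ : ∀ (k : ℕ) (m : Fin M), ∀ᵐ ω ∂P, 𝓜.t ω = k → 𝓜.O ω = m →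
      Tendsto (fun n : ℕ => 𝓜.Z k m (k + n) ω / (n : EReal)) atTop (𝓝 (q m : EReal)))
    {C : ℝ} (hC : C = 1 / (M : ℝ) * ∑ m : Fin M, 1 / (q m + |Real.log (1 - 𝓜.ρ)|))
    (hC0 : 0 < C) {δ : ℝ} (hδ0 : 0 < δ) (hδ1 : δ < 1) :
    ∀ᶠ α in 𝓝[>] (0 : ℝ),
      ENNReal.ofReal ((1 - δ) * (C * |Real.log α|)) ≤ ⨅ T ∈ 𝓜.Δ α, 𝓜.ADD T := by
  have h0 := 𝓜.ρ_pos
  have h1 := sub_pos.2 𝓜.ρ_lt_one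
  -- half of the loss `δ` is due to change points from `K` on, half to the shortened delay
  obtain ⟨K, hK⟩ := exists_pow_lt_of_lt_one (show 0 < δ / 2 by linarith)
    (show 1 - 𝓜.ρ < 1 by linarith)
  set e := δ / 2 with he
  have he0 : 0 < e := by linarith
  have he1 : e < 1 := by linarith
  let F : ℝ → ℝ := fun α => ∑ p ∈ Finset.range K ×ˢ (Finset.univ : Finset (Fin M)),
    (𝓜.delay e (q p.2) α : ℝ) *
      (𝓜.ρ * (1 - 𝓜.ρ) ^ p.1 / M - 𝓜.earlyBound p.1 p.2 e (q p.2) α)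
  have hF : Tendsto (fun α => F α / |Real.log α|) (𝓝[>] 0)
      (𝓝 (∑ p ∈ Finset.range K ×ˢ (Finset.univ : Finset (Fin M)),
        (1 - e) / (q p.2 + |Real.log (1 - 𝓜.ρ)|) * (𝓜.ρ * (1 - 𝓜.ρ) ^ p.1 / M - 0))) := by
    simp only [F, Finset.sum_div]
    refine tendsto_finsetSum _ fun p _ => ?_
    refine ((𝓜.tendsto_delay_div he1 (hq p.2)).mul
      ((tendsto_const_nhds (x := 𝓜.ρ * (1 - 𝓜.ρ) ^ p.1 / M)).sub
        (𝓜.tendsto_earlyBound he0 he1 (hq p.2) (hZ p.1 p.2)))).congr fun α => ?_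
    rw [div_mul_eq_mul_div]
  have hsum : ∑ p ∈ Finset.range K ×ˢ (Finset.univ : Finset (Fin M)),
        (1 - e) / (q p.2 + |Real.log (1 - 𝓜.ρ)|) * (𝓜.ρ * (1 - 𝓜.ρ) ^ p.1 / M - 0) =
      (1 - e) * (1 - (1 - 𝓜.ρ) ^ K) * C := by
    have hgeom : ∑ k ∈ Finset.range K, 𝓜.ρ * (1 - 𝓜.ρ) ^ k = 1 - (1 - 𝓜.ρ) ^ K := by
      rw [← Finset.mul_sum, ← mul_neg_geom_sum, sub_sub_cancel]
    rw [Finset.sum_product, hC, ← hgeom, Finset.mul_sum, Finset.sum_mul]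
    refine Finset.sum_congr rfl fun k _ => ?_
    rw [Finset.mul_sum, Finset.mul_sum]
    refine Finset.sum_congr rfl fun m _ => ?_
    ring
  have hlt : (1 - δ) * C < (1 - e) * (1 - (1 - 𝓜.ρ) ^ K) * C := by
    refine mul_lt_mul_of_pos_right ?_ hC0
    have : 0 < (1 - 𝓜.ρ) ^ K := by positivity
    nlinarith
  rw [hsum] at hF
  filter_upwards [hF.eventually_const_lt hlt, Ioo_mem_nhdsGT (zero_lt_one (α := ℝ))] with α hα hα'
  have hL : 0 < |Real.log α| := abs_pos.2 (Real.log_neg hα'.1 hα'.2).ne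
  rw [lt_div_iff₀ hL, mul_assoc] at hα
  refine le_iInf₂ fun T hT => ?_
  refine (ENNReal.ofReal_le_ofReal (hα.le.trans (Finset.sum_le_sum fun p _ => ?_))).trans
    (𝓜.ofReal_sum_le_ADD hT.1 K fun m => 𝓜.delay e (q m) α)
  refine mul_le_mul_of_nonneg_left ?_ (Nat.cast_nonneg _)
  rw [← 𝓜.measureReal_changeEvent]
  exact 𝓜.measureReal_changeEvent_sub_le hρ₁ hα'.1 hT p.1 _ p.2 _

end RadialModel

theorem lemma3 {Ω : Type*} [MeasurableSpace Ω] (P : Measure Ω) [IsProbabilityMeasure P]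
    (M : ℕ) (𝓜 : RadialModel P M) (hρ₁ : 𝓜.ρ₁ = 1) (q : Fin M → ℝ)
    (hZ : ∀ (k : ℕ) (m : Fin M), ∀ᵐ ω ∂P, 𝓜.t ω = k → 𝓜.O ω = m →
      Tendsto (fun n : ℕ => 𝓜.Z k m (k + n) ω / (n : EReal)) atTop (𝓝 (q m : EReal))) :
    ∃ ε : ℝ → ℝ, Tendsto ε (𝓝[>] 0) (𝓝 0) ∧
      ∀ α : ℝ, 0 < α → α < 1 →
        ENNReal.ofReal ((1 / (M : ℝ)) *
          ∑ m : Fin M, |Real.log α| / (q m + |Real.log (1 - 𝓜.ρ)|) * (1 + ε α)) ≤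
        ⨅ T ∈ 𝓜.Δ α, 𝓜.ADD T := by
  have hq : ∀ m, 0 ≤ q m := fun m => 𝓜.limit_nonneg hρ₁ (hZ 0 m)
  have hd := 𝓜.abs_log_one_sub_pos
  obtain ⟨ω⟩ := nonempty_of_isProbabilityMeasure P
  have : Nonempty (Fin M) := ⟨𝓜.O ω⟩
  have hM : (0 : ℝ) < M := by exact_mod_cast (Nat.zero_le _).trans_lt (𝓜.O ω).2
  have hC0 : 0 < 1 / (M : ℝ) * ∑ m : Fin M, 1 / (q m + |Real.log (1 - 𝓜.ρ)|) :=
    mul_pos (by positivity) (Finset.sum_pos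
      (fun m _ => one_div_pos.2 (add_pos_of_nonneg_of_pos (hq m) hd)) Finset.univ_nonempty)
  obtain ⟨ε, hε, h⟩ := exists_tendsto_zero_of_eventually_le
    (fun α => ⨅ T ∈ 𝓜.Δ α, 𝓜.ADD T) (fun α => |Real.log α|) hC0
    (fun α h0 h1 => abs_pos.2 (Real.log_neg h0 h1).ne)
    (fun δ h0 h1 => 𝓜.eventually_le_iInf_ADD hρ₁ hq hZ rfl hC0 h0 h1)
  refine ⟨ε, hε, fun α h0 h1 => (le_of_eq ?_).trans (h α h0 h1)⟩
  congr 1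
  rw [mul_assoc, mul_assoc, Finset.sum_mul]
  congr 1
  refine Finset.sum_congr rfl fun m _ => ?_
  ring
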